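/- Let $G=(V,E)$ be an infinite, connected, locally finite graph without loops or multiple edges, and let $d$ be its combinatorial distance. Let $\Delta f(x)=\sum_{y\sim x}(f(x)-f(y))$ be its Laplacian. For a finite set $D\subset V$ let $\Delta_D$ be the Laplacian with Dirichlet boundary conditions on $D$ (extend a function on $D$ by zero to $V$, apply $\Delta$, restrict to $D$), and let $p^D_t(x,y)$ be the kernel of $e^{-t\Delta_D}$, extended by zero to $V\times V$. The heat kernel of $G$ is the limit $p_t(x,y)=\lim_{D\uparrow V}p^D_t(x,y)=\sup_{D}p^D_t(x,y)$ of these kernels (which increase with $D$), and $G$ is called stochastically complete if \[ \sum_{y\in V}p_t(x,y)=1\qquad\text{for all } t>0 \text{ and all } x\in V. \] Fix a vertex $x_0\in V$. For $r\ge 0$ let $S_r=\{x\in V : d(x,x_0)=r\}$, for $x\in S_r$ let $m_+(x)=|\{y : y\sim x,\ d(y,x_0)=r+1\}|$, and let $K_+(r)=\max_{x\in S_r}m_+(x)$ (so $1\le K_+(r)<\infty$). Theorem. If \[ \sum_{r=0}^{\infty}\frac{1}{K_+(r)}=\infty, \] then $G$ is stochastically complete. -/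

import Mathlib

namespace GraphHeat

noncomputable section

variable {V : Type*} (G : SimpleGraph V) [G.LocallyFinite]

/-- The (positive, unnormalised) graph Laplacian `Δ f (x) = ∑_{y ∼ x} (f x - f y)`, acting on
arbitrary real-valued functions on the vertices. -/
def laplacian (f : V → ℝ) (x : V) : ℝ :=
  ∑ y ∈ G.neighborFinset x, (f x - f y)

/-- The sphere `S_r(x₀)` of radius `r` about `x₀` in the combinatorial graph distance. -/
def sphere {V : Type*} (G : SimpleGraph V) (x₀ : V) (r : ℕ) : Set V :=
  {x | G.dist x₀ x = r}

/-- `m₊(x)`: the number of neighbours of `x` that are one step further from `x₀` than `x` is. -/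
def outerDegree (x₀ x : V) : ℕ :=
  ((G.neighborFinset x).filter (fun y => G.dist x₀ y = G.dist x₀ x + 1)).card

/-- `K₊(r) = max_{x ∈ S_r(x₀)} m₊(x)`. On a connected, infinite, locally finite graph the spheres
are finite and non-empty, so that this supremum is a maximum; see `isGreatest_maxOuterDegree`
and `maxOuterDegree_pos`. -/
def maxOuterDegree (x₀ : V) (r : ℕ) : ℕ :=
  sSup (outerDegree G x₀ '' sphere G x₀ r)

section Spheres

variable {V : Type*} (G : SimpleGraph V)

theorem exists_adj_dist (hconn : G.Connected) (x₀ y : V) (r : ℕ) (h : G.dist x₀ y = r + 1) :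
    ∃ x, G.dist x₀ x = r ∧ G.Adj x y := by
  obtain ⟨p, hp⟩ := (hconn y x₀).exists_walk_length_eq_dist
  rw [SimpleGraph.dist_comm, h] at hp
  cases p with
  | nil => simp at hp
  | @cons _ x _ hyx q =>
    refine ⟨x, ?_, hyx.symm⟩
    have h1 : q.length = r := by simpa using hp
    have h2 := SimpleGraph.dist_le q
    have h3 := hconn.dist_triangle (u := x₀) (v := x) (w := y)
    have h4 : G.dist x y = 1 := SimpleGraph.dist_eq_one_iff_adj.2 hyx.symm
    rw [SimpleGraph.dist_comm] at h2
    omega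

theorem sphere_finite [G.LocallyFinite] (hconn : G.Connected) (x₀ : V) (r : ℕ) :
    (sphere G x₀ r).Finite := by
  induction r with
  | zero =>
    refine (Set.finite_singleton x₀).subset fun x hx => ?_
    exact ((hconn.dist_eq_zero_iff).1 hx).symm
  | succ r ih =>
    refine (ih.biUnion fun x _ => (G.neighborFinset x).finite_toSet).subset fun y hy => ?_
    obtain ⟨x, hx, hxy⟩ := exists_adj_dist G hconn x₀ y r hy
    exact Set.mem_biUnion (show x ∈ sphere G x₀ r from hx) (by simpa using hxy)

theorem sphere_nonempty [Infinite V] [G.LocallyFinite] (hconn : G.Connected) (x₀ : V) (r : ℕ) :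
    (sphere G x₀ r).Nonempty := by
  by_contra hne
  have key : ∀ k, ∀ y, G.dist x₀ y ≠ r + k := by
    intro k
    induction k with
    | zero => exact fun y hy => hne ⟨y, hy⟩
    | succ k ih =>
      intro y hy
      obtain ⟨x, hx, -⟩ := exists_adj_dist G hconn x₀ y (r + k) hy
      exact ih x hx
  refine Set.infinite_univ (α := V)
    (((Set.finite_Iio r).biUnion fun i _ => sphere_finite G hconn x₀ i).subset fun y _ => ?_)
  refine Set.mem_biUnion (x := G.dist x₀ y) ?_ rfl
  by_contra hlt
  exact key (G.dist x₀ y - r) y (by simp only [Set.mem_Iio] at hlt; omega)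

/-- `K₊(r)` is indeed a maximum, over a finite non-empty sphere. -/
theorem isGreatest_maxOuterDegree [Infinite V] [G.LocallyFinite] (hconn : G.Connected)
    (x₀ : V) (r : ℕ) :
    IsGreatest (outerDegree G x₀ '' sphere G x₀ r) (maxOuterDegree G x₀ r) :=
  have hfin := (sphere_finite G hconn x₀ r).image (outerDegree G x₀)
  ⟨Nat.sSup_mem ((sphere_nonempty G hconn x₀ r).image _) hfin.bddAbove,
    fun _ hm => le_csSup hfin.bddAbove hm⟩

/-- `K₊(r)` is positive, so that its reciprocal has its usual meaning. -/
theorem maxOuterDegree_pos [Infinite V] [G.LocallyFinite] (hconn : G.Connected)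
    (x₀ : V) (r : ℕ) : 0 < maxOuterDegree G x₀ r := by
  obtain ⟨y, hy⟩ := sphere_nonempty G hconn x₀ (r+1)
  obtain ⟨x, hx, hxy⟩ := exists_adj_dist G hconn x₀ y r hy
  refine lt_of_lt_of_le ?_ ((isGreatest_maxOuterDegree G hconn x₀ r).2 ⟨x, hx, rfl⟩)
  refine Finset.card_pos.2 ⟨y, ?_⟩
  have : G.dist x₀ y = r+1 := hy
  simp [hxy, hx, this]

end Spheres

variable [DecidableEq V]

/-- The Laplacian with Dirichlet boundary conditions on a finite set `D` of vertices: extend a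
function on `D` by zero to all vertices, apply the Laplacian of `G`, and restrict to `D`. This is
its matrix with respect to the indicator functions of the points of `D`. -/
def dirichletLaplacian (D : Finset V) : Matrix D D ℝ :=
  Matrix.of fun x y => laplacian G (Pi.single (y : V) (1 : ℝ)) (x : V)

/-- The heat kernel with Dirichlet boundary conditions on the finite set `D`: the kernel of
`exp (-t Δ_D)`, extended by zero to all pairs of vertices. -/
def dirichletHeatKernel (D : Finset V) (t : ℝ) (x y : V) : ℝ :=
  if h : x ∈ D ∧ y ∈ D then
    NormedSpace.exp (-t • dirichletLaplacian G D) ⟨x, h.1⟩ ⟨y, h.2⟩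
  else 0

/-- The heat kernel `p_t(x,y)` of the graph (the transition function of the minimal diffusion
process associated to the Laplacian), by exhaustion. The Dirichlet heat kernels are non-negative and
increase with `D`, so their limit along any exhaustion of `V` by finite sets is their supremum; it
is taken in `[0, ∞]`. -/
def heatKernel (t : ℝ) (x y : V) : ENNReal :=
  ⨆ D : Finset V, ENNReal.ofReal (dirichletHeatKernel G D t x y)

/-- The graph is stochastically complete if the heat kernel has total mass one:
`∑_y p_t(x,y) = 1` for all `t > 0` and all vertices `x`. -/
def StochasticallyComplete : Prop :=
  ∀ t : ℝ, 0 < t → ∀ x : V, ∑' y : V, heatKernel G t x y = 1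

end

end GraphHeat

/-! Let `f` be `radialPotential`. Only outward edges make `Δ f` negative: at distance `r` there are
at most `K₊(r)` of them, each contributing `-1/K₊(r)`. Hence `Δ f ≥ -1`, while divergence of the
series makes `f` tend to infinity. On a ball `D` with `f ≥ M` outside, put `v = 1 - f/M`. Off `D`,
`v ≤ 0`, so extending by zero costs nothing and `-Δ_D v ≥ -1/M`. As `exp(-tΔ_D)` is positive and
sub-Markovian, `exp(-tΔ_D) 1 ≥ exp(-tΔ_D) v ≥ v - t/M`, which tends to `1` as `M → ∞`
(`one_sub_le_sum_dirichletHeatKernel`). The upper bound on the mass is the sub-Markov property,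
passed to the supremum over `D`. -/

namespace Matrix

open scoped Matrix.Norms.Operator

variable {m n : Type*} [Fintype m] [DecidableEq m] [Fintype n] [DecidableEq n]

/-! ### Positivity and comparison for matrix exponentials -/

theorem hasSum_exp_apply (A : Matrix n n ℝ) (i j : n) :
    HasSum (fun k : ℕ => ((k.factorial : ℝ)⁻¹) * (A ^ k) i j) (NormedSpace.exp A i j) := by
  have h := NormedSpace.exp_series_hasSum_exp' (𝕂 := ℝ) A
  exact Pi.hasSum.1 (Pi.hasSum.1 h i) j

theorem exp_apply_nonneg {A : Matrix n n ℝ} (hA : ∀ i j, 0 ≤ A i j) (i j : n) :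
    0 ≤ NormedSpace.exp A i j :=
  (hasSum_exp_apply A i j).nonneg fun k => mul_nonneg (by positivity) (pow_apply_nonneg hA k i j)

theorem pow_submatrix_apply_le {B : Matrix m m ℝ} (hB : ∀ i j, 0 ≤ B i j) (e : n ↪ m)
    (k : ℕ) (i j : n) : ((B.submatrix e e) ^ k) i j ≤ (B ^ k) (e i) (e j) := by
  induction k generalizing i j with
  | zero => simp [Matrix.one_apply]
  | succ k ih =>
    rw [pow_succ, pow_succ, Matrix.mul_apply, Matrix.mul_apply]
    calc ∑ l, ((B.submatrix e e) ^ k) i l * B (e l) (e j)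
        ≤ ∑ l, (B ^ k) (e i) (e l) * B (e l) (e j) :=
          Finset.sum_le_sum fun l _ => mul_le_mul_of_nonneg_right (ih i l) (hB _ _)
      _ = ∑ l ∈ Finset.univ.map e, (B ^ k) (e i) l * B l (e j) := by rw [Finset.sum_map]
      _ ≤ ∑ l, (B ^ k) (e i) l * B l (e j) :=
          Finset.sum_le_sum_of_subset_of_nonneg (Finset.subset_univ _) fun l _ _ =>
            mul_nonneg (pow_apply_nonneg hB k _ _) (hB _ _)

theorem exp_submatrix_apply_le {B : Matrix m m ℝ} (hB : ∀ i j, 0 ≤ B i j) (e : n ↪ m)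
    (i j : n) : NormedSpace.exp (B.submatrix e e) i j ≤ NormedSpace.exp B (e i) (e j) :=
  hasSum_le (fun k => mul_le_mul_of_nonneg_left (pow_submatrix_apply_le hB e k i j) (by positivity))
    (hasSum_exp_apply _ i j) (hasSum_exp_apply B (e i) (e j))

/-- A shift by a multiple of the identity makes `-tΔ_D` entrywise nonnegative, so that power series
can be compared term by term. -/
theorem exp_eq_smul_exp_add_smul_one (A : Matrix n n ℝ) (c : ℝ) :
    NormedSpace.exp A = Real.exp (-c) • NormedSpace.exp (A + c • (1 : Matrix n n ℝ)) := by
  have h1 : A = (-c) • (1 : Matrix n n ℝ) + (A + c • (1 : Matrix n n ℝ)) := by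
    rw [neg_smul]; abel
  have h2 : NormedSpace.exp ((-c) • (1 : Matrix n n ℝ)) = Real.exp (-c) • (1 : Matrix n n ℝ) := by
    rw [smul_one_eq_diagonal, Matrix.exp_diagonal, smul_one_eq_diagonal, Real.exp_eq_exp_ℝ]
    congr 1
    funext i
    exact congrFun (Pi.exp_def _) i
  conv_lhs => rw [h1]
  rw [Matrix.exp_add_of_commute _ _ ((Commute.one_left _).smul_left _), h2, smul_one_mul]

/-- A one-sided bound on the generator applied to `v` gives a linear lower bound on the orbit. -/
theorem sub_mul_le_exp_mulVec_apply {B : Matrix n n ℝ} {v : n → ℝ} {i : n} {a : ℝ}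
    (h : ∀ s : ℝ, 0 ≤ s → -a ≤ (NormedSpace.exp (s • B) *ᵥ (B *ᵥ v)) i) {t : ℝ} (ht : 0 ≤ t) :
    v i - a * t ≤ (NormedSpace.exp (t • B) *ᵥ v) i := by
  have hd : ∀ s : ℝ, HasDerivAt (fun u : ℝ => (NormedSpace.exp (u • B) *ᵥ v) i + a * u)
      ((NormedSpace.exp (s • B) *ᵥ (B *ᵥ v)) i + a) s := by
    intro s
    have h1 := hasDerivAt_exp_smul_const (𝕂 := ℝ) B s
    have h2 : HasDerivAt (fun u : ℝ => (NormedSpace.exp (u • B) *ᵥ v) i)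
        (((NormedSpace.exp (s • B) * B) *ᵥ v) i) s := by
      simp only [Matrix.mulVec, dotProduct]
      refine HasDerivAt.fun_sum fun j _ => HasDerivAt.mul_const ?_ _
      exact hasDerivAt_pi.1 (hasDerivAt_pi.1 h1 i) j
    rw [← Matrix.mulVec_mulVec] at h2
    simpa using h2.fun_add ((hasDerivAt_id' s).const_mul a)
  have hm : MonotoneOn (fun u : ℝ => (NormedSpace.exp (u • B) *ᵥ v) i + a * u) (Set.Ici 0) := by
    refine monotoneOn_of_deriv_nonneg (convex_Ici 0)
      (fun s _ => (hd s).continuousAt.continuousWithinAt)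
      (fun s _ => (hd s).differentiableAt.differentiableWithinAt) fun s hs => ?_
    rw [(hd s).deriv]
    have := h s (interior_subset hs)
    linarith
  have := hm (Set.mem_Ici.2 le_rfl) (Set.mem_Ici.2 ht) ht
  simp only [zero_smul, NormedSpace.exp_zero, Matrix.one_mulVec, mul_zero, add_zero] at this
  linarith

end Matrix

namespace GraphHeat

open Matrix Filter Topology

variable {V : Type*} (G : SimpleGraph V) [G.LocallyFinite]

/-! ### The radial potential -/

/-- The potential `∑_{s < d(x₀, x)} 1 / K₊(s)`. -/
noncomputable def radialPotential (x₀ x : V) : ℝ :=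
  ∑ r ∈ Finset.range (G.dist x₀ x), 1 / (maxOuterDegree G x₀ r : ℝ)

theorem sum_one_div_maxOuterDegree_mono (x₀ : V) :
    Monotone fun n : ℕ => ∑ r ∈ Finset.range n, 1 / (maxOuterDegree G x₀ r : ℝ) :=
  fun _ _ h => Finset.sum_le_sum_of_subset_of_nonneg (Finset.range_mono h) fun _ _ _ => by positivity

theorem radialPotential_nonneg (x₀ x : V) : 0 ≤ radialPotential G x₀ x :=
  Finset.sum_nonneg fun _ _ => by positivity

theorem neg_one_le_laplacian_radialPotential [Infinite V] (hconn : G.Connected) (x₀ x : V) :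
    -1 ≤ laplacian G (radialPotential G x₀) x := by
  obtain ⟨K, hKdef⟩ : ∃ K : ℝ, K = (maxOuterDegree G x₀ (G.dist x₀ x) : ℝ) := ⟨_, rfl⟩
  have hK : 0 < K := hKdef ▸ Nat.cast_pos.2 (maxOuterDegree_pos G hconn x₀ _)
  have hm : (outerDegree G x₀ x : ℝ) ≤ K :=
    hKdef ▸ Nat.cast_le.2 ((isGreatest_maxOuterDegree G hconn x₀ (G.dist x₀ x)).2 ⟨x, rfl, rfl⟩)
  calc (-1 : ℝ) ≤ (outerDegree G x₀ x : ℝ) * (-(1 / K)) := by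
        rw [mul_neg, neg_le_neg_iff, mul_one_div]
        exact (div_le_one hK).2 hm
    _ = ∑ y ∈ G.neighborFinset x, if G.dist x₀ y = G.dist x₀ x + 1 then -(1 / K) else 0 := by
        rw [← Finset.sum_filter, Finset.sum_const, nsmul_eq_mul]; rfl
    _ ≤ _ := by
        refine Finset.sum_le_sum fun y hy => ?_
        have hadj : G.Adj x y := (G.mem_neighborFinset x y).1 hy
        split_ifs with h
        · rw [radialPotential, radialPotential, h, Finset.sum_range_succ]
          simp [hKdef]
        · have h1 := hconn.dist_triangle (u := x₀) (v := x) (w := y)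
          rw [SimpleGraph.dist_eq_one_iff_adj.2 hadj] at h1
          exact sub_nonneg.2 (sum_one_div_maxOuterDegree_mono G x₀ (by omega))

variable [DecidableEq V]

/-! ### Dirichlet heat kernels -/

theorem dirichletLaplacian_apply (D : Finset V) (x y : D) :
    dirichletLaplacian G D x y =
      (if x = y then (G.degree x : ℝ) else 0) - if (y : V) ∈ G.neighborFinset x then 1 else 0 := by
  simp only [dirichletLaplacian, Matrix.of_apply, laplacian, Finset.sum_sub_distrib,
    Finset.sum_const, Pi.single_apply, Finset.sum_ite_eq', 
    SimpleGraph.card_neighborFinset_eq_degree, Subtype.coe_inj, nsmul_eq_mul, mul_ite, mul_one,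
    mul_zero]

theorem dirichletLaplacian_mulVec (D : Finset V) (f : V → ℝ) (x : D) :
    (dirichletLaplacian G D *ᵥ fun y => f y) x =
      laplacian G (fun y => if y ∈ D then f y else 0) x := by
  have h : ∀ y, (if y ∈ D then f y else 0) =
      ∑ z : D, Pi.single (M := fun _ => ℝ) (z : V) (1 : ℝ) y * f z := by
    intro y
    rw [Finset.sum_coe_sort D fun z => Pi.single (M := fun _ => ℝ) z (1 : ℝ) y * f z]
    simp [Pi.single_apply]
  simp only [laplacian, h, ← Finset.sum_sub_distrib, ← sub_mul]
  rw [Finset.sum_comm]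
  simp only [← Finset.sum_mul]
  rfl

theorem exists_shift_nonneg (D : Finset V) {t : ℝ} (ht : 0 ≤ t) :
    ∃ c : ℝ, ∀ x y : D, 0 ≤ (t • (-dirichletLaplacian G D) + c • (1 : Matrix D D ℝ)) x y := by
  -- The sum of all degrees dominates each diagonal entry of `Δ_D`.
  refine ⟨t * ∑ x ∈ D, (G.degree x : ℝ), fun x y => ?_⟩
  have hx : (G.degree x : ℝ) ≤ ∑ x ∈ D, (G.degree x : ℝ) :=
    Finset.single_le_sum (f := fun x => (G.degree x : ℝ)) (fun _ _ => by positivity) x.2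
  simp only [Matrix.add_apply, Matrix.smul_apply, Matrix.neg_apply, dirichletLaplacian_apply,
    Matrix.one_apply, smul_eq_mul]
  rw [mul_assoc, ← mul_add]
  refine mul_nonneg ht ?_
  split_ifs <;> linarith

theorem exp_dirichletLaplacian_nonneg (D : Finset V) {t : ℝ} (ht : 0 ≤ t) (x y : D) :
    0 ≤ NormedSpace.exp (t • (-dirichletLaplacian G D)) x y := by
  obtain ⟨c, hc⟩ := exists_shift_nonneg G D ht
  rw [exp_eq_smul_exp_add_smul_one _ c]
  exact mul_nonneg (Real.exp_pos _).le (exp_apply_nonneg hc x y)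

theorem dirichletHeatKernel_eq (D : Finset V) (t : ℝ) (x y : D) :
    dirichletHeatKernel G D t x y = NormedSpace.exp (t • (-dirichletLaplacian G D)) x y := by
  rw [dirichletHeatKernel, dif_pos ⟨x.2, y.2⟩, smul_neg, neg_smul]

theorem dirichletHeatKernel_nonneg (D : Finset V) {t : ℝ} (ht : 0 ≤ t) (x y : V) :
    0 ≤ dirichletHeatKernel G D t x y := by
  by_cases h : x ∈ D ∧ y ∈ D
  · rw [dirichletHeatKernel_eq G D t ⟨x, h.1⟩ ⟨y, h.2⟩]
    exact exp_dirichletLaplacian_nonneg G D ht _ _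
  · rw [dirichletHeatKernel, dif_neg h]

theorem dirichletHeatKernel_mono {t : ℝ} (ht : 0 ≤ t) (x y : V) :
    Monotone fun D : Finset V => dirichletHeatKernel G D t x y := by
  intro D D' hD
  by_cases h : x ∈ D ∧ y ∈ D
  · let e : D ↪ D' := ⟨fun z => ⟨z, hD z.2⟩, fun a b hab => Subtype.ext (congrArg (fun z => z.1) hab)⟩
    obtain ⟨c, hc⟩ := exists_shift_nonneg G D' ht
    -- `Δ_D` is a principal submatrix of `Δ_{D'}`; the same shift `c` serves both, so the factors
    -- `exp(-c)` agree.
    have hsub : t • (-dirichletLaplacian G D) + c • (1 : Matrix D D ℝ) =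
        (t • (-dirichletLaplacian G D') + c • (1 : Matrix D' D' ℝ)).submatrix e e := by
      rw [← Matrix.submatrix_one_embedding e]
      rfl
    have key := exp_submatrix_apply_le hc e ⟨x, h.1⟩ ⟨y, h.2⟩
    rw [← hsub] at key
    show dirichletHeatKernel G D t x y ≤ dirichletHeatKernel G D' t x y
    rw [dirichletHeatKernel_eq G D t ⟨x, h.1⟩ ⟨y, h.2⟩,
      dirichletHeatKernel_eq G D' t ⟨x, hD h.1⟩ ⟨y, hD h.2⟩, exp_eq_smul_exp_add_smul_one _ c,
      exp_eq_smul_exp_add_smul_one (t • (-dirichletLaplacian G D')) c]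
    exact mul_le_mul_of_nonneg_left key (Real.exp_pos _).le
  · show dirichletHeatKernel G D t x y ≤ dirichletHeatKernel G D' t x y
    rw [dirichletHeatKernel, dif_neg h]
    exact dirichletHeatKernel_nonneg G D' ht x y

theorem exp_dirichletLaplacian_mulVec_mono (D : Finset V) {t : ℝ} (ht : 0 ≤ t) {v w : D → ℝ}
    (h : ∀ y, v y ≤ w y) (x : D) :
    (NormedSpace.exp (t • (-dirichletLaplacian G D)) *ᵥ v) x ≤
      (NormedSpace.exp (t • (-dirichletLaplacian G D)) *ᵥ w) x :=
  Finset.sum_le_sum fun y _ =>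
    mul_le_mul_of_nonneg_left (h y) (exp_dirichletLaplacian_nonneg G D ht x y)

/-- Edges leaving `D` only lose heat: `-Δ_D` applied to `-1` counts them, so the orbit of `-1` stays
above `-1`. -/
theorem exp_dirichletLaplacian_mulVec_one_le (D : Finset V) {t : ℝ} (ht : 0 ≤ t) (x : D) :
    (NormedSpace.exp (t • (-dirichletLaplacian G D)) *ᵥ fun _ => 1) x ≤ 1 := by
  have hgen : ∀ y : D, 0 ≤ (-dirichletLaplacian G D *ᵥ fun _ => (-1 : ℝ)) y := by
    intro y
    rw [Matrix.neg_mulVec, Pi.neg_apply, dirichletLaplacian_mulVec G D (fun _ => -1) y, laplacian,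
      ← Finset.sum_neg_distrib]
    refine Finset.sum_nonneg fun z _ => ?_
    rw [if_pos y.2]
    split_ifs <;> norm_num
  have := sub_mul_le_exp_mulVec_apply (B := -dirichletLaplacian G D) (v := fun _ => -1) (i := x)
    (a := 0) (fun s hs => by
      have := exp_dirichletLaplacian_mulVec_mono G D hs (v := fun _ => 0) hgen x
      simpa [Matrix.mulVec, dotProduct] using this) ht
  simp only [Matrix.mulVec, dotProduct, mul_neg, Finset.sum_neg_distrib] at this ⊢
  linarith

theorem sum_dirichletHeatKernel_eq (D : Finset V) (t : ℝ) (x : D) :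
    ∑ y ∈ D, dirichletHeatKernel G D t x y =
      (NormedSpace.exp (t • (-dirichletLaplacian G D)) *ᵥ fun _ => 1) x := by
  rw [← Finset.sum_coe_sort D]
  simp [Matrix.mulVec, dotProduct, dirichletHeatKernel_eq]

theorem sum_dirichletHeatKernel_le_one (D : Finset V) {t : ℝ} (ht : 0 ≤ t) (x : V)
    (s : Finset V) : ∑ y ∈ s, dirichletHeatKernel G D t x y ≤ 1 := by
  by_cases hx : x ∈ D
  · calc ∑ y ∈ s, dirichletHeatKernel G D t x y
        ≤ ∑ y ∈ s ∪ D, dirichletHeatKernel G D t x y :=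
          Finset.sum_le_sum_of_subset_of_nonneg Finset.subset_union_left
            fun y _ _ => dirichletHeatKernel_nonneg G D ht x y
      _ = ∑ y ∈ D, dirichletHeatKernel G D t x y :=
          (Finset.sum_subset Finset.subset_union_right fun y _ hy => by
            rw [dirichletHeatKernel, dif_neg fun h => hy h.2]).symm
      _ ≤ 1 := by
          rw [sum_dirichletHeatKernel_eq G D t ⟨x, hx⟩]
          exact exp_dirichletLaplacian_mulVec_one_le G D ht _
  · rw [Finset.sum_eq_zero fun y _ => by rw [dirichletHeatKernel, dif_neg fun h => hx h.1]]
    exact zero_le_one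

/-! ### Total mass -/

theorem tsum_heatKernel_le_one {t : ℝ} (ht : 0 ≤ t) (x : V) : ∑' y, heatKernel G t x y ≤ 1 := by
  rw [ENNReal.tsum_eq_iSup_sum]
  refine iSup_le fun s => ?_
  have hmono : ∀ y, Monotone fun D : Finset V => ENNReal.ofReal (dirichletHeatKernel G D t x y) :=
    fun y _ _ h => ENNReal.ofReal_le_ofReal (dirichletHeatKernel_mono G ht x y h)
  simp only [heatKernel]
  rw [ENNReal.finsetSum_iSup_of_monotone hmono]
  refine iSup_le fun D => ?_
  rw [← ENNReal.ofReal_sum_of_nonneg fun y _ => dirichletHeatKernel_nonneg G D ht x y]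
  exact ENNReal.ofReal_le_one.2 (sum_dirichletHeatKernel_le_one G D ht x s)

theorem ofReal_sum_dirichletHeatKernel_le (D : Finset V) {t : ℝ} (ht : 0 ≤ t) (x : V) :
    ENNReal.ofReal (∑ y ∈ D, dirichletHeatKernel G D t x y) ≤ ∑' y, heatKernel G t x y := by
  rw [ENNReal.ofReal_sum_of_nonneg fun y _ => dirichletHeatKernel_nonneg G D ht x y]
  exact (Finset.sum_le_sum fun y _ =>
    le_iSup (fun D : Finset V => ENNReal.ofReal (dirichletHeatKernel G D t x y)) D).trans
      (ENNReal.sum_le_tsum D)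

/-- If `f ≥ 0` satisfies `Δ f ≥ -1` and `f ≥ M` off `D`, then the heat lost from `D` up to time
`t` is at most `(f + t) / M`. -/
theorem one_sub_le_sum_dirichletHeatKernel (D : Finset V) {t : ℝ} (ht : 0 ≤ t) {f : V → ℝ}
    (hf : ∀ y, 0 ≤ f y) (hΔ : ∀ y, -1 ≤ laplacian G f y) {M : ℝ} (hM : 0 < M)
    (hD : ∀ y, y ∉ D → M ≤ f y) {x : V} (hx : x ∈ D) :
    1 - (f x + t) / M ≤ ∑ y ∈ D, dirichletHeatKernel G D t x y := by
  rw [sum_dirichletHeatKernel_eq G D t ⟨x, hx⟩]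
  have hgen : ∀ y : D, -(1 / M) ≤ (-dirichletLaplacian G D *ᵥ fun z => 1 - f z / M) y := by
    intro y
    rw [Matrix.neg_mulVec, Pi.neg_apply, neg_le_neg_iff,
      dirichletLaplacian_mulVec G D (fun z => 1 - f z / M) y]
    calc laplacian G (fun z => if z ∈ D then 1 - f z / M else 0) y
        ≤ ∑ z ∈ G.neighborFinset y, -((f y - f z) / M) := by
          refine Finset.sum_le_sum fun z _ => ?_
          simp only [y.2, if_true]
          split_ifs with hz
          · exact le_of_eq (by ring)
          · have := (one_le_div hM).2 (hD z hz)
            rw [sub_div]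
            linarith
      _ = -laplacian G f y / M := by
          rw [Finset.sum_neg_distrib, ← Finset.sum_div, neg_div]; rfl
      _ ≤ 1 / M := by
          gcongr
          linarith [hΔ y]
  have key := sub_mul_le_exp_mulVec_apply (B := -dirichletLaplacian G D)
    (v := fun z : D => 1 - f z / M) (i := ⟨x, hx⟩) (a := 1 / M) (fun s hs => by
      refine le_trans ?_ (exp_dirichletLaplacian_mulVec_mono G D hs hgen ⟨x, hx⟩)
      -- The sub-Markov property keeps the image of the constant `-1/M` above `-1/M`.
      have h1 := mul_le_mul_of_nonneg_left (exp_dirichletLaplacian_mulVec_one_le G D hs ⟨x, hx⟩)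
        (one_div_pos.2 hM).le
      simp only [Matrix.mulVec, dotProduct, ← Finset.sum_mul, mul_one] at h1 ⊢
      linarith) ht
  refine le_trans (le_of_eq ?_) (key.trans
    (exp_dirichletLaplacian_mulVec_mono G D ht (fun y => ?_) ⟨x, hx⟩))
  · ring
  · exact sub_le_self _ (div_nonneg (hf y) hM.le)

end GraphHeat

open GraphHeat in
theorem theorem4p1 {V : Type*} [DecidableEq V] [Infinite V]
    (G : SimpleGraph V) [G.LocallyFinite] (hconn : G.Connected) (x₀ : V)
    (hK : Filter.Tendsto
      (fun n : ℕ => ∑ r ∈ Finset.range n, 1 / (GraphHeat.maxOuterDegree G x₀ r : ℝ))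
      Filter.atTop Filter.atTop) :
    GraphHeat.StochasticallyComplete G := by
  intro t ht x
  refine le_antisymm (tsum_heatKernel_le_one G ht.le x) ?_
  have hlim : Filter.Tendsto (fun n : ℕ => ENNReal.ofReal (1 - (radialPotential G x₀ x + t) /
      ∑ r ∈ Finset.range n, 1 / (maxOuterDegree G x₀ r : ℝ))) Filter.atTop (nhds 1) := by
    simpa using ENNReal.tendsto_ofReal ((hK.const_div_atTop (radialPotential G x₀ x + t)).const_sub 1)
  refine le_of_tendsto hlim ?_
  filter_upwards [hK.eventually_gt_atTop 0, Filter.eventually_gt_atTop (G.dist x₀ x)] with n hM hn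
  -- Take `D = {d < n}`: off it the potential is at least the `n`-th partial sum, which serves as
  -- `M`.
  have hfin : {y | G.dist x₀ y < n}.Finite :=
    ((Set.finite_Iio n).biUnion fun i _ => sphere_finite G hconn x₀ i).subset fun y hy =>
      Set.mem_biUnion (Set.mem_Iio.2 hy) rfl
  refine le_trans (ENNReal.ofReal_le_ofReal ?_)
    (ofReal_sum_dirichletHeatKernel_le G hfin.toFinset ht.le x)
  refine one_sub_le_sum_dirichletHeatKernel G _ ht.le (radialPotential_nonneg G x₀)
    (neg_one_le_laplacian_radialPotential G hconn x₀) hM (fun y hy => ?_) (by simpa using hn)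
  exact sum_one_div_maxOuterDegree_mono G x₀ (by simpa using hy)
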